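/- Let $n\ge 0$ be an integer. Let $K^C_{n+1}$ be the complete signed graph of type $C$ on the vertex set $\{1,\dots,n+1\}$: its edges are $(i,j,+)$ and $(i,j,-)$ for $1\le i<j\le n+1$, and the loops $(i,i,+)$ for $1\le i\le n+1$; let $E$ be its edge set. To an edge $(i,j,\pm)$ associate the vector $\mathbf v(i,j,\pm)=\mathbf e_i\pm\mathbf e_j\in\mathbb Z^{n+1}$ (so $\mathbf v(i,i,+)=2\mathbf e_i$). Let $$CRYC_{n+1}=\Big\{\, b\in\mathbb R_{\ge 0}^{E} \;:\; \sum_{e\in E} b(e)\,\mathbf v(e)=(2,0,\dots,0)\,\Big\}$$ be the flow polytope of $K^C_{n+1}$ with netflow $(2,0,\dots,0)$. For a $d$-dimensional polytope $P\subset\mathbb R^E$ with rational affine span, let $\mathrm{vol}(P)$ denote its normalized volume, i.e. $d!$ times its $d$-dimensional volume, where the volume on the affine span of $P$ is scaled so that a fundamental parallelepiped of the lattice of integer vectors parallel to that affine span has volume $1$. For a rational function $f$ in $x_1,\dots,x_{n-1}$, let $CT_{x_i}f$ denote the constant term of the Laurent expansion of $f$ in $x_i$ at $x_i=0$, the other variables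 being considered as constants. Then $$\mathrm{vol}(CRYC_{n+1}) = CT_{x_{n-1}}CT_{x_{n-2}}\cdots CT_{x_1}\ \prod_{i=1}^{n-1}x_i^{-1}(1-x_i)^{-2}(1-2x_i)^{-1}\prod_{1\le i<j\le n-1}(x_j-x_i)^{-1}(1-x_j-x_i)^{-1},$$ where $CT_{x_1}$ is applied first (for $n\le 1$ there are no variables and the right-hand side is $1$). -/

import Mathlib

open scoped Nat

/-! ### Signed graphs and their flow polytopes -/

/-- A finite signed (multi)graph with linearly ordered vertex set `V` and edges indexed by `E`.
The edge `e` is `(left e, right e, +)` if `positive e`, and `(left e, right e, -)` otherwise;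
loops are positive. -/
structure SignedGraph (V E : Type*) [LinearOrder V] where
  left : E → V
  right : E → V
  positive : E → Bool
  left_le_right : ∀ e, left e ≤ right e
  positive_of_loop : ∀ e, left e = right e → positive e = true

namespace SignedGraph

variable {V E : Type*} [LinearOrder V]

/-- The root of an edge: `e_i - e_j` for `(i, j, -)` and `e_i + e_j` for `(i, j, +)`
(so `2 e_i` for a loop at `i`). -/
def root (G : SignedGraph V E) (e : E) : V → ℤ :=
  Pi.single (G.left e) 1 +
    if G.positive e then Pi.single (G.right e) 1 else -Pi.single (G.right e) 1

/-- The matrix whose columns are the roots of the edges. -/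
def rootMatrix (G : SignedGraph V E) : Matrix V E ℤ :=
  Matrix.of fun v e => G.root e v

/-- The flow polytope: all nonnegative real flows on the edges with netflow `a`. -/
def flowPolytope [Fintype E] (G : SignedGraph V E) (a : V → ℤ) : Set (EuclideanSpace ℝ E) :=
  {b | (∀ e, 0 ≤ b e) ∧
    (G.rootMatrix.map (Int.cast : ℤ → ℝ)).mulVec (fun e => b e) = fun v => (a v : ℝ)}

end SignedGraph

/-- The edges of the complete type `C` signed graph on `Fin m`: all `(i, j, ±)` with `i < j`,
and all loops `(i, i, +)`. -/
abbrev CompleteCEdge (m : ℕ) : Type :=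
  {e : Fin m × Fin m × Bool // e.1 < e.2.1 ∨ (e.1 = e.2.1 ∧ e.2.2 = true)}

/-- The complete type `C` signed graph on `m` vertices. -/
def completeC (m : ℕ) : SignedGraph (Fin m) (CompleteCEdge m) where
  left e := e.1.1
  right e := e.1.2.1
  positive e := e.1.2.2
  left_le_right e := e.2.elim le_of_lt fun h => h.1.le
  positive_of_loop e h := e.2.elim (fun h' => absurd h h'.ne) fun h' => h'.2

/-- The polytope `CRYC_{n+1}`: the flow polytope of the complete type `C` signed graph on `n + 1`
vertices with netflow `(2, 0, …, 0)`. -/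
def CRYC (n : ℕ) : Set (EuclideanSpace ℝ (CompleteCEdge (n + 1))) :=
  (completeC (n + 1)).flowPolytope (Pi.single 0 2)

/-! ### Normalized volume -/

section NormalizedVolume

variable {ι : Type*} [Fintype ι]

/-- The integer points of the linear space parallel to the affine span of `P`. -/
noncomputable def directionLattice (P : Set (EuclideanSpace ℝ ι)) :
    Submodule ℤ (vectorSpan ℝ P) :=
  (Submodule.span ℤ (Set.range (EuclideanSpace.basisFun ι ℝ))).comap
    ((vectorSpan ℝ P).subtype.restrictScalars ℤ)

open Classical in
/-- The normalized volume of a (rational) polytope `P` of dimension `d`: `d!` times the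
`d`-dimensional volume of `P` in its affine span (identified with its direction by the choice of a
base point in `P`), in units of the covolume of the lattice of integer points.
A unimodular integer simplex of dimension `d` thus has normalized volume `1`. -/
noncomputable def normalizedVolume (P : Set (EuclideanSpace ℝ ι)) : ℝ :=
  if h : P.Nonempty then
    (Module.finrank ℝ (vectorSpan ℝ P))! *
      (MeasureTheory.volume.real {v : vectorSpan ℝ P | (v : EuclideanSpace ℝ ι) + h.some ∈ P} /
        ZLattice.covolume (directionLattice P))
  else 0

end NormalizedVolume

/-! ### Iterated constant terms of rational functions -/

/-- The field of rational functions in the variables `x_i`, `i : σ`, over `ℝ`. -/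
abbrev RatFun (σ : Type*) : Type _ := FractionRing (MvPolynomial σ ℝ)

namespace RatFun

variable {σ : Type*}

/-- The variable `x_i` as a rational function. -/
noncomputable def x (i : σ) : RatFun σ :=
  algebraMap (MvPolynomial σ ℝ) (RatFun σ) (MvPolynomial.X i)

variable [DecidableEq σ]

/-- A polynomial, seen as a polynomial in the single variable `x_i` (written `T`) whose
coefficients involve only the other variables. -/
noncomputable def asPolynomialIn (i : σ) : MvPolynomial σ ℝ →ₐ[ℝ] Polynomial (RatFun σ) :=
  MvPolynomial.aeval fun j => if j = i then Polynomial.X else Polynomial.C (x j)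

theorem asPolynomialIn_injective (i : σ) : Function.Injective (asPolynomialIn i) := by
  have h : ((Polynomial.aeval (x i)).restrictScalars ℝ).comp (asPolynomialIn i) =
      IsScalarTower.toAlgHom ℝ (MvPolynomial σ ℝ) (RatFun σ) := by
    apply MvPolynomial.algHom_ext
    intro j
    by_cases hj : j = i
    · subst hj; simp [asPolynomialIn, x]
    · simp [asPolynomialIn, x, hj]
  intro p q hpq
  apply IsFractionRing.injective (MvPolynomial σ ℝ) (RatFun σ)
  have hp := DFunLike.congr_fun h p
  have hq := DFunLike.congr_fun h q
  simp only [AlgHom.comp_apply, hpq] at hp hq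
  exact hp.symm.trans hq

/-- A polynomial, seen as a Laurent series in `x_i` over the field of rational functions. -/
noncomputable def polyToLaurent (i : σ) : MvPolynomial σ ℝ →+* LaurentSeries (RatFun σ) :=
  (algebraMap (Polynomial (RatFun σ)) (LaurentSeries (RatFun σ))).comp
    (asPolynomialIn i : MvPolynomial σ ℝ →+* Polynomial (RatFun σ))

theorem polyToLaurent_injective (i : σ) : Function.Injective (polyToLaurent i) :=
  (FaithfulSMul.algebraMap_injective (Polynomial (RatFun σ)) (LaurentSeries (RatFun σ))).comp
    (asPolynomialIn_injective i)

/-- The Laurent expansion of a rational function in the variable `x_i` at `x_i = 0`, the other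
variables being considered as constants. -/
noncomputable def laurentExpansion (i : σ) : RatFun σ →+* LaurentSeries (RatFun σ) :=
  IsFractionRing.lift (polyToLaurent_injective i)

/-- `CT_{x_i} f`, the constant term of the Laurent expansion of `f` in `x_i`. -/
noncomputable def CT (i : σ) (f : RatFun σ) : RatFun σ :=
  (laurentExpansion i f).coeff 0

/-- The iterated constant term `CT_{x_m} ⋯ CT_{x_2} CT_{x_1} f` (the first variable comes
first). -/
noncomputable def iteratedCT {m : ℕ} (f : RatFun (Fin m)) : RatFun (Fin m) :=
  (List.finRange m).foldl (fun g i => CT i g) f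

end RatFun

/-! Both sides satisfy the same recursion, `flowCount`, which removes one vertex (one variable) at a
time.

Volume side. Take as free coordinates the flows on the edges among the last `n` vertices and the
flows `p_j` on the positive edges from the first vertex. The negative edges from the first vertex
then carry `m_j = p_j + netflow_j`, and its loop carries `1 - ℓ` with `ℓ = ∑ (p_j + m_j) / 2`. These
coordinates are unimodular (`normalizedVolume_image`), so the polytope becomes a cone cut off by `ℓ
≤ 1`, and `d!` times its volume is the integral of `exp (-ℓ)` over the cone
(`lintegral_cone_exp_neg`). The exponential factors over the vertices; integrating out each `p_j`
leaves `∏ twoSidedKernel 0 0 (netflow_j)`, integrated over all nonnegative flows: this is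
`flowIntegral`.

Dictionary. A vertex carrying `twoSidedKernel a b` corresponds to a factor `x⁻ᵃ (1 - x)⁻⁽ᵇ⁺¹⁾`.
Expanding the kernel of the first vertex multinomially and integrating over its edges
(`flowIntegral_succ`) corresponds to extracting the coefficient of `x ^ a` from the remaining
factors (`RatFun.CT_kernelProduct`): a loop gives `(1 - 2x)⁻¹`, a negative edge `(x_j - x)⁻¹`, a
positive edge `(1 - x_j - x)⁻¹`. Starting from zero exponents, one trivial step of the recursion
leaves `n - 1` vertices with `a = b = 1`, which is the stated product. -/

open MeasureTheory Set
open scoped ENNReal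

/-! ### Gamma kernels -/

/-- The function `t ↦ t ^ a / a! * exp (-t / 2)` on the half line `t ≥ 0`, extended by zero. -/
noncomputable def gammaKernel (a : ℕ) (t : ℝ) : ℝ≥0∞ :=
  if 0 ≤ t then ENNReal.ofReal (t ^ a / a ! * Real.exp (-t / 2)) else 0

theorem gammaKernel_of_nonneg (a : ℕ) {t : ℝ} (ht : 0 ≤ t) :
    gammaKernel a t = ENNReal.ofReal (t ^ a / a ! * Real.exp (-t / 2)) := if_pos ht

theorem gammaKernel_of_neg (a : ℕ) {t : ℝ} (ht : t < 0) : gammaKernel a t = 0 :=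
  if_neg ht.not_ge

@[fun_prop]
theorem measurable_gammaKernel (a : ℕ) : Measurable (gammaKernel a) := by
  unfold gammaKernel
  exact Measurable.ite measurableSet_Ici (by fun_prop) measurable_const

theorem lintegral_pow_mul_exp_neg (a : ℕ) :
    ∫⁻ t in Ioi (0 : ℝ), ENNReal.ofReal (t ^ a * Real.exp (-t)) = a ! := by
  have h1 : IntegrableOn (fun t : ℝ => t ^ a * Real.exp (-t)) (Ioi 0) := by
    have := Real.GammaIntegral_convergent (s := (a : ℝ) + 1) (by positivity)
    refine this.congr_fun (fun t _ => ?_) measurableSet_Ioi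
    simp [mul_comm]
  rw [← ofReal_integral_eq_lintegral_ofReal h1]
  · have := Real.Gamma_eq_integral (s := (a : ℝ) + 1) (by positivity)
    rw [Real.Gamma_nat_eq_factorial] at this
    rw [← ENNReal.ofReal_natCast, this]
    congr 1
    refine setIntegral_congr_fun measurableSet_Ioi (fun t _ => ?_)
    simp [mul_comm]
  · filter_upwards [ae_restrict_mem measurableSet_Ioi] with t ht
    have : (0 : ℝ) < t := ht
    positivity

/-- The contribution of a loop, whose root is `2 e_i`: the answer is the coefficient of `x ^ c` in
`(1 - 2x)⁻¹`. -/
theorem lintegral_gammaKernel_two_mul (c : ℕ) :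
    ∫⁻ t, gammaKernel c (2 * t) = 2 ^ c := by
  have h : ∀ t : ℝ, gammaKernel c (2 * t) =
      (Ici (0 : ℝ)).indicator
        (fun t => ENNReal.ofReal (2 ^ c / c !) * ENNReal.ofReal (t ^ c * Real.exp (-t))) t := by
    intro t
    by_cases ht : 0 ≤ t
    · rw [indicator_of_mem (mem_Ici.2 ht), gammaKernel_of_nonneg _ (by positivity),
        ← ENNReal.ofReal_mul (by positivity)]
      congr 1
      rw [mul_pow, show -(2 * t) / 2 = -t by ring]
      ring
    · rw [indicator_of_notMem (by simpa using ht), gammaKernel_of_neg _ (by linarith)]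
  simp_rw [h]
  rw [lintegral_indicator measurableSet_Ici, lintegral_const_mul _ (by fun_prop),
    setLIntegral_congr Ioi_ae_eq_Ici.symm, lintegral_pow_mul_exp_neg, ← ENNReal.ofReal_natCast,
    ← ENNReal.ofReal_mul (by positivity), div_mul_cancel₀ _ (by positivity),
    ENNReal.ofReal_pow (by norm_num)]
  simp

/-- Two decays of rate `1/2` combine to `exp (-t)`, so a Gamma integral remains. The value is the
coefficient of `x ^ k` in `(1 - x)⁻⁽ᵇ⁺¹⁾`. -/
theorem lintegral_gammaKernel_mul_gammaKernel (b k : ℕ) :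
    ∫⁻ t, gammaKernel b t * gammaKernel k t = ((k + b).choose k : ℕ) := by
  have h : ∀ t : ℝ, gammaKernel b t * gammaKernel k t =
      (Ici (0 : ℝ)).indicator
        (fun t => ENNReal.ofReal (1 / (b ! * k !)) *
          ENNReal.ofReal (t ^ (k + b) * Real.exp (-t))) t := by
    intro t
    by_cases ht : 0 ≤ t
    · rw [indicator_of_mem (mem_Ici.2 ht), gammaKernel_of_nonneg _ ht, gammaKernel_of_nonneg _ ht,
        ← ENNReal.ofReal_mul (by positivity), ← ENNReal.ofReal_mul (by positivity)]
      congr 1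
      have he : Real.exp (-t) = Real.exp (-t / 2) * Real.exp (-t / 2) := by
        rw [← Real.exp_add]
        ring_nf
      rw [he, pow_add]
      ring
    · rw [indicator_of_notMem (by simpa using ht), gammaKernel_of_neg _ (by linarith), zero_mul]
  simp_rw [h]
  rw [lintegral_indicator measurableSet_Ici, lintegral_const_mul _ (by fun_prop),
    setLIntegral_congr Ioi_ae_eq_Ici.symm, lintegral_pow_mul_exp_neg, ← ENNReal.ofReal_natCast,
    ← ENNReal.ofReal_mul (by positivity), ← ENNReal.ofReal_natCast,
    Nat.cast_choose ℝ (Nat.le_add_right k b), Nat.add_sub_cancel_left]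
  congr 1
  field_simp

theorem gammaKernel_zero_lconvolution (a : ℕ) :
    gammaKernel 0 ⋆ₗ gammaKernel a = gammaKernel (a + 1) := by
  ext x
  rw [lconvolution_def]
  have h : ∀ y : ℝ, gammaKernel 0 y * gammaKernel a (-y + x) =
      (Icc (0 : ℝ) x).indicator
        (fun y => ENNReal.ofReal ((x - y) ^ a / a ! * Real.exp (-x / 2))) y := by
    intro y
    by_cases hy : 0 ≤ y
    · by_cases hx : y ≤ x
      · have hx' : 0 ≤ -y + x := by linarith
        rw [indicator_of_mem (mem_Icc.2 ⟨hy, hx⟩), gammaKernel_of_nonneg _ hy,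
          gammaKernel_of_nonneg _ hx', ← ENNReal.ofReal_mul (by positivity)]
        congr 1
        rw [show -x / 2 = -y / 2 + -(-y + x) / 2 by ring, Real.exp_add]
        simp
        ring
      · rw [indicator_of_notMem (by simp [hx]), gammaKernel_of_neg a (by linarith), mul_zero]
    · rw [indicator_of_notMem (by simp [hy]), gammaKernel_of_neg 0 (by linarith), zero_mul]
  simp_rw [h]
  rw [lintegral_indicator measurableSet_Icc]
  by_cases hx : 0 ≤ x
  · rw [gammaKernel_of_nonneg _ hx, ← ofReal_integral_eq_lintegral_ofReal]
    · congr 1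
      rw [integral_Icc_eq_integral_Ioc, ← intervalIntegral.integral_of_le hx]
      rw [intervalIntegral.integral_comp_sub_left
        (fun u => u ^ a / a ! * Real.exp (-x / 2)) x]
      simp [Nat.factorial_succ]
      field_simp
    · exact (Continuous.integrableOn_Icc (by fun_prop))
    · filter_upwards [ae_restrict_mem measurableSet_Icc] with y hy
      have : 0 ≤ x - y := by linarith [hy.2]
      positivity
  · rw [gammaKernel_of_neg _ (by linarith), Icc_eq_empty hx]
    simp

/-- The kernel of index `a` is the `(a + 1)`-fold convolution power of the kernel of index `0`, so
`a + 1` is additive. -/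
theorem gammaKernel_lconvolution (a b : ℕ) :
    gammaKernel a ⋆ₗ gammaKernel b = gammaKernel (b + a + 1) := by
  induction a with
  | zero => exact gammaKernel_zero_lconvolution b
  | succ a ih =>
    rw [← gammaKernel_zero_lconvolution, ← lconvolution_assoc (by fun_prop) (by fun_prop)
      (by fun_prop), ih, gammaKernel_zero_lconvolution]
    rfl

/-- Expansion of a gamma kernel at a sum of nonnegative numbers. -/
theorem gammaKernel_sum {ι : Type*} [Fintype ι] [DecidableEq ι] (a : ℕ) (t : ι → ℝ)
    (ht : ∀ i, 0 ≤ t i) :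
    gammaKernel a (∑ i, t i) =
      ∑ l ∈ Finset.piAntidiag Finset.univ a, ∏ i, gammaKernel (l i) (t i) := by
  rw [gammaKernel_of_nonneg _ (Finset.sum_nonneg fun i _ => ht i)]
  have h : ∀ l : ι → ℕ, ∏ i, gammaKernel (l i) (t i) =
      ENNReal.ofReal (∏ i, (t i ^ l i / (l i)! * Real.exp (-t i / 2))) := by
    intro l
    rw [ENNReal.ofReal_prod_of_nonneg fun i _ => ?_]
    · exact Finset.prod_congr rfl fun i _ => gammaKernel_of_nonneg _ (ht i)
    · have := ht i
      positivity
  simp_rw [h]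
  rw [← ENNReal.ofReal_sum_of_nonneg fun l _ => Finset.prod_nonneg fun i _ => ?_]
  · congr 1
    -- The multinomial theorem; dividing by `a!` turns each multinomial coefficient into a product
    -- of inverse factorials, and the exponential is multiplicative.
    rw [Finset.sum_pow_eq_sum_piAntidiag, Finset.sum_div, Finset.sum_mul]
    refine Finset.sum_congr rfl fun l hl => ?_
    have hl' : ∑ i, l i = a := (Finset.mem_piAntidiag.1 hl).1
    have hm := Nat.multinomial_spec Finset.univ l
    rw [hl'] at hm
    rw [Finset.prod_mul_distrib, Finset.prod_div_distrib, ← Real.exp_sum, ← Finset.sum_div,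
      Finset.sum_neg_distrib, ← hm]
    have : (0 : ℝ) < ∏ i, ((l i)! : ℝ) := by positivity
    have h2 : 0 < Nat.multinomial Finset.univ l := Nat.multinomial_pos _ _
    have h3 : (0 : ℝ) < Nat.multinomial Finset.univ l := by exact_mod_cast h2
    push_cast
    field_simp
  · have := ht i
    positivity

/-- The cross-correlation of two gamma kernels. -/
noncomputable def twoSidedKernel (a b : ℕ) (y : ℝ) : ℝ≥0∞ :=
  ∫⁻ q, gammaKernel b q * gammaKernel a (q + y)

@[fun_prop]
theorem measurable_twoSidedKernel (a b : ℕ) : Measurable (twoSidedKernel a b) := by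
  unfold twoSidedKernel
  fun_prop

/-- Substituting `r = p + q` convolves the kernels of index `c` and `b`. Thus a positive edge raises
`b` at its far end. -/
theorem lintegral_gammaKernel_mul_twoSidedKernel_add (a b c : ℕ) (y : ℝ) :
    ∫⁻ p, gammaKernel c p * twoSidedKernel a b (y + p) = twoSidedKernel a (b + c + 1) y := by
  unfold twoSidedKernel
  have h : ∀ p : ℝ, gammaKernel c p * ∫⁻ q, gammaKernel b q * gammaKernel a (q + (y + p)) =
      ∫⁻ r, gammaKernel c p * gammaKernel b (-p + r) * gammaKernel a (r + y) := by
    intro p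
    rw [← lintegral_const_mul _ (by fun_prop), ← lintegral_add_left_eq_self _ (-p)]
    refine lintegral_congr fun r => ?_
    rw [mul_assoc, show -p + r + (y + p) = r + y by ring]
  simp_rw [h]
  rw [lintegral_lintegral_swap (by fun_prop)]
  refine lintegral_congr fun r => ?_
  rw [lintegral_mul_const _ (by fun_prop), ← gammaKernel_lconvolution c b, lconvolution_def]

/-- Here the kernel of index `c` is absorbed into the one of index `a`: a negative edge raises `a`
at its far end. -/
theorem lintegral_gammaKernel_mul_twoSidedKernel_sub (a b c : ℕ) (y : ℝ) :
    ∫⁻ m, gammaKernel c m * twoSidedKernel a b (y - m) = twoSidedKernel (a + c + 1) b y := by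
  unfold twoSidedKernel
  have h : ∀ m : ℝ, gammaKernel c m * ∫⁻ q, gammaKernel b q * gammaKernel a (q + (y - m)) =
      ∫⁻ q, gammaKernel c m * (gammaKernel b q * gammaKernel a (q + (y - m))) := fun m =>
    (lintegral_const_mul _ (by fun_prop)).symm
  simp_rw [h]
  rw [lintegral_lintegral_swap (by fun_prop)]
  refine lintegral_congr fun q => ?_
  rw [← gammaKernel_lconvolution c a, lconvolution_def, ← lintegral_const_mul _ (by fun_prop)]
  refine lintegral_congr fun m => ?_
  rw [mul_left_comm, show q + (y - m) = -m + (q + y) by ring]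

/-- Expansion of the cross-correlation kernel at a sum of nonnegative numbers. -/
theorem twoSidedKernel_sum {ι : Type*} [Fintype ι] [DecidableEq ι] (a b : ℕ) (t : ι → ℝ)
    (ht : ∀ i, 0 ≤ t i) :
    twoSidedKernel a b (∑ i, t i) =
      ∑ l ∈ Finset.piAntidiag (Finset.univ : Finset (Option ι)) a,
        ((l none + b).choose (l none) : ℝ≥0∞) * ∏ i, gammaKernel (l (some i)) (t i) := by
  unfold twoSidedKernel
  -- The integration variable `q` is one more summand, indexed by `none`; for `q < 0` both sides
  -- vanish.
  have h : ∀ q : ℝ, gammaKernel b q * gammaKernel a (q + ∑ i, t i) =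
      ∑ l ∈ Finset.piAntidiag (Finset.univ : Finset (Option ι)) a,
        gammaKernel b q * gammaKernel (l none) q * ∏ i, gammaKernel (l (some i)) (t i) := by
    intro q
    by_cases hq : 0 ≤ q
    · have := gammaKernel_sum a (fun i : Option ι => i.elim q t)
        (by rintro (_ | i) <;> simp [hq, ht])
      simp only [Fintype.sum_option, Fintype.prod_option, Option.elim] at this
      rw [this, Finset.mul_sum]
      simp_rw [mul_assoc]
    · simp [gammaKernel_of_neg b (not_le.1 hq)]
  simp_rw [h]
  rw [lintegral_finsetSum _ (by fun_prop)]
  refine Finset.sum_congr rfl fun l _ => ?_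
  rw [lintegral_mul_const _ (by fun_prop), lintegral_gammaKernel_mul_gammaKernel]

/-! ### The recursion shared by both sides -/

/-- A multi-index recursion which removes the first of `k` vertices. Distributing the exponent
`a 0` over a slot `none`, the loop `some none` and the edges `some (some _)` to the other vertices
raises the exponents at those vertices. -/
def flowCount : (k : ℕ) → (Fin k → ℕ) → (Fin k → ℕ) → ℕ
  | 0, _, _ => 1
  | k + 1, a, b =>
    ∑ l ∈ Finset.piAntidiag (Finset.univ : Finset (Option (Option (Fin k ⊕ Fin k)))) (a 0),
      (l none + b 0).choose (l none) * 2 ^ l (some none) *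
        flowCount k (fun j => a j.succ + l (some (some (.inr j))) + 1)
          (fun j => b j.succ + l (some (some (.inl j))) + 1)

/-- Exponent `0` can only be distributed as `l = 0`. This is why the constant term needs one
variable fewer than there are vertices left. -/
theorem flowCount_succ_zero (k : ℕ) :
    flowCount (k + 1) (fun _ => 0) (fun _ => 0) = flowCount k (fun _ => 1) (fun _ => 1) := by
  simp [flowCount]

theorem PowerSeries.coeff_prod_univ {R ι : Type*} [CommSemiring R] [Fintype ι] [DecidableEq ι]
    (f : ι → PowerSeries R) (d : ℕ) :
    PowerSeries.coeff d (∏ i, f i) =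
      ∑ l ∈ Finset.piAntidiag Finset.univ d, ∏ i, PowerSeries.coeff (l i) (f i) := by
  rw [PowerSeries.coeff_prod]
  refine Finset.sum_bij' (fun l _ => ⇑l) (fun l _ => Finsupp.equivFunOnFinite.symm l)
    ?_ ?_ ?_ ?_ ?_ <;> simp

theorem PowerSeries.C_sub_C_mul_X_mul_mk {K : Type*} [Field K] {u : K} (hu : u ≠ 0) (v : K) :
    (PowerSeries.C u - PowerSeries.C v * PowerSeries.X) *
      PowerSeries.mk (fun n => v ^ n * u⁻¹ ^ (n + 1)) = 1 := by
  ext n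
  rw [sub_mul, mul_assoc, map_sub, PowerSeries.coeff_C_mul, PowerSeries.coeff_C_mul]
  cases n with
  | zero => simp [hu]
  | succ n =>
    rw [PowerSeries.coeff_succ_X_mul, PowerSeries.coeff_mk, PowerSeries.coeff_mk,
      PowerSeries.coeff_one, if_neg n.succ_ne_zero]
    linear_combination v ^ (n + 1) * u⁻¹ ^ (n + 1) * mul_inv_cancel₀ hu

/-! ### Constant terms -/

namespace RatFun

variable {σ : Type*}

theorem x_ne_zero (i : σ) : x i ≠ 0 := by
  rw [x, Ne, map_eq_zero_iff _ (IsFractionRing.injective (MvPolynomial σ ℝ) (RatFun σ))]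
  exact MvPolynomial.X_ne_zero i

theorem one_sub_x_ne_zero (i : σ) : 1 - x i ≠ 0 := by
  rw [x, ← map_one (algebraMap (MvPolynomial σ ℝ) (RatFun σ)), ← map_sub, Ne,
    map_eq_zero_iff _ (IsFractionRing.injective (MvPolynomial σ ℝ) (RatFun σ))]
  intro h
  have := congrArg (MvPolynomial.eval fun _ => (0 : ℝ)) h
  simp at this

/-- The rational function whose iterated constant term is `flowCount k a b`. -/
noncomputable def kernelProduct {k : ℕ} (v : Fin k → σ) (a b : Fin k → ℕ) : RatFun σ :=
  (∏ i, (x (v i))⁻¹ ^ a i * ((1 - x (v i)) ^ (b i + 1))⁻¹ * (1 - 2 * x (v i))⁻¹) *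
    ∏ i, ∏ j ∈ Finset.Ioi i, (x (v j) - x (v i))⁻¹ * (1 - x (v j) - x (v i))⁻¹

theorem kernelProduct_succ {k : ℕ} (v : Fin (k + 1) → σ) (a b : Fin (k + 1) → ℕ) :
    kernelProduct v a b =
      (x (v 0))⁻¹ ^ a 0 *
        (((1 - x (v 0)) ^ (b 0 + 1))⁻¹ * ((1 - 2 * x (v 0))⁻¹ *
          ((∏ j : Fin k, (1 - x (v j.succ) - x (v 0))⁻¹) *
            ∏ j : Fin k, (x (v j.succ) - x (v 0))⁻¹))) *
        kernelProduct (v ∘ Fin.succ) (a ∘ Fin.succ) (b ∘ Fin.succ) := by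
  unfold kernelProduct
  rw [Fin.prod_univ_succ, Fin.prod_univ_succ, Fin.prod_Ioi_zero]
  simp_rw [Fin.prod_Ioi_succ]
  rw [Finset.prod_mul_distrib (f := fun j : Fin k => (x (v j.succ) - x (v 0))⁻¹)]
  simp only [Function.comp_apply]
  ring

theorem kernelProduct_mul_pow {k : ℕ} (v : Fin k → σ) (a b c d : Fin k → ℕ) :
    (∏ j, (1 - x (v j))⁻¹ ^ (d j + 1)) * (∏ j, (x (v j))⁻¹ ^ (c j + 1)) * kernelProduct v a b =
      kernelProduct v (fun j => a j + c j + 1) (fun j => b j + d j + 1) := by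
  unfold kernelProduct
  rw [← Finset.prod_mul_distrib, ← mul_assoc, ← Finset.prod_mul_distrib]
  congr 1
  refine Finset.prod_congr rfl fun j _ => ?_
  simp only [← inv_pow]
  ring

variable [DecidableEq σ]

theorem laurentExpansion_x_self (i : σ) :
    laurentExpansion i (x i) = HahnSeries.ofPowerSeries ℤ (RatFun σ) PowerSeries.X := by
  unfold laurentExpansion x
  rw [IsFractionRing.lift_algebraMap]
  simp [polyToLaurent, asPolynomialIn, Polynomial.algebraMap_hahnSeries_apply]

theorem laurentExpansion_x_of_ne {i j : σ} (h : j ≠ i) :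
    laurentExpansion i (x j) = HahnSeries.ofPowerSeries ℤ (RatFun σ) (PowerSeries.C (x j)) := by
  unfold laurentExpansion
  conv_lhs => rw [x]
  rw [IsFractionRing.lift_algebraMap]
  simp [polyToLaurent, asPolynomialIn, h, Polynomial.algebraMap_hahnSeries_apply]

/-- The expansion is a homomorphism of fields, so exhibiting an inverse power series suffices. -/
theorem laurentExpansion_inv {i : σ} {f : RatFun σ} {p q : PowerSeries (RatFun σ)}
    (hf : laurentExpansion i f = HahnSeries.ofPowerSeries ℤ (RatFun σ) p) (hpq : p * q = 1) :
    laurentExpansion i f⁻¹ = HahnSeries.ofPowerSeries ℤ (RatFun σ) q := by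
  rw [map_inv₀, hf]
  refine inv_eq_of_mul_eq_one_right ?_
  rw [← map_mul, hpq, map_one]

theorem laurentExpansion_inv_one_sub_pow (i : σ) (b : ℕ) :
    laurentExpansion i ((1 - x i) ^ (b + 1))⁻¹ = HahnSeries.ofPowerSeries ℤ (RatFun σ)
      (PowerSeries.mk fun n => ((n + b).choose n : RatFun σ)) := by
  refine laurentExpansion_inv (p := (1 - PowerSeries.X) ^ (b + 1)) ?_ ?_
  · rw [map_pow, map_sub, map_one, laurentExpansion_x_self, map_pow, map_sub, map_one]
  · have h := (PowerSeries.invOneSubPow (RatFun σ) (b + 1)).inv_mul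
    rw [PowerSeries.invOneSubPow_val_succ_eq_mk_add_choose, ← Units.inv_eq_val_inv,
      PowerSeries.invOneSubPow_inv_eq_one_sub_pow] at h
    have hc : (fun n => ((n + b).choose n : RatFun σ)) = fun n => ((b + n).choose b : RatFun σ) := by
      ext n
      rw [add_comm n b, Nat.choose_symm_add]
    rw [hc, h]

theorem laurentExpansion_inv_one_sub_two_mul (i : σ) :
    laurentExpansion i (1 - 2 * x i)⁻¹ = HahnSeries.ofPowerSeries ℤ (RatFun σ)
      (PowerSeries.mk fun n => (2 : RatFun σ) ^ n) := by
  refine laurentExpansion_inv (p := PowerSeries.C 1 - PowerSeries.C 2 * PowerSeries.X) ?_ ?_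
  · rw [map_sub, map_mul, laurentExpansion_x_self, map_sub, map_mul, map_ofNat, map_ofNat,
      map_ofNat, map_one, map_one, map_one]
  · simpa using PowerSeries.C_sub_C_mul_X_mul_mk (one_ne_zero (α := RatFun σ)) 2

theorem laurentExpansion_inv_sub {i j : σ} (h : j ≠ i) :
    laurentExpansion i (x j - x i)⁻¹ = HahnSeries.ofPowerSeries ℤ (RatFun σ)
      (PowerSeries.mk fun n => (x j)⁻¹ ^ (n + 1)) := by
  refine laurentExpansion_inv
    (p := PowerSeries.C (x j) - PowerSeries.C 1 * PowerSeries.X) ?_ ?_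
  · rw [map_sub, laurentExpansion_x_self, laurentExpansion_x_of_ne h]
    simp
  · simpa using PowerSeries.C_sub_C_mul_X_mul_mk (x_ne_zero j) 1

theorem laurentExpansion_inv_one_sub_sub {i j : σ} (h : j ≠ i) :
    laurentExpansion i (1 - x j - x i)⁻¹ = HahnSeries.ofPowerSeries ℤ (RatFun σ)
      (PowerSeries.mk fun n => (1 - x j)⁻¹ ^ (n + 1)) := by
  refine laurentExpansion_inv
    (p := PowerSeries.C (1 - x j) - PowerSeries.C 1 * PowerSeries.X) ?_ ?_
  · rw [map_sub, map_sub, laurentExpansion_x_self, laurentExpansion_x_of_ne h]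
    simp
  · simpa using PowerSeries.C_sub_C_mul_X_mul_mk (one_sub_x_ne_zero j) 1

theorem laurentExpansion_kernelProduct {k : ℕ} {v : Fin k → σ} {i : σ} (hv : ∀ j, v j ≠ i)
    (a b : Fin k → ℕ) :
    laurentExpansion i (kernelProduct v a b) = HahnSeries.C (kernelProduct v a b) := by
  have h : ∀ j, laurentExpansion i (x (v j)) = HahnSeries.C (x (v j)) := fun j => by
    rw [laurentExpansion_x_of_ne (hv j), HahnSeries.ofPowerSeries_C]
  unfold kernelProduct
  simp only [map_mul, map_prod, map_inv₀, map_pow, map_sub, map_one, map_ofNat, h]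

theorem CT_kernelProduct {k : ℕ} {v : Fin (k + 1) → σ} (hv : Function.Injective v)
    (a b : Fin (k + 1) → ℕ) :
    CT (v 0) (kernelProduct v a b) =
      ∑ l ∈ Finset.piAntidiag (Finset.univ : Finset (Option (Option (Fin k ⊕ Fin k)))) (a 0),
        (((l none + b 0).choose (l none) * 2 ^ l (some none) : ℕ) : RatFun σ) *
          kernelProduct (v ∘ Fin.succ) (fun j => a j.succ + l (some (some (.inr j))) + 1)
            (fun j => b j.succ + l (some (some (.inl j))) + 1) := by
  have hne : ∀ j : Fin k, v j.succ ≠ v 0 := fun j h => Fin.succ_ne_zero j (hv h)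
  -- One power series per slot of `flowCount`: `(1 - x)⁻⁽ᵇ⁺¹⁾`, the loop, the positive edges, the
  -- negative edges.
  let f : Option (Option (Fin k ⊕ Fin k)) → PowerSeries (RatFun σ) := fun o =>
    o.elim (PowerSeries.mk fun n => ((n + b 0).choose n : RatFun σ)) fun o =>
      o.elim (PowerSeries.mk fun n => (2 : RatFun σ) ^ n)
        (Sum.elim (fun j => PowerSeries.mk fun n => (1 - x (v j.succ))⁻¹ ^ (n + 1))
          fun j => PowerSeries.mk fun n => (x (v j.succ))⁻¹ ^ (n + 1))
  have hL : laurentExpansion (v 0) (kernelProduct v a b) =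
      HahnSeries.single (-(a 0 : ℤ)) 1 *
        (HahnSeries.ofPowerSeries ℤ (RatFun σ) (∏ o, f o) *
          HahnSeries.C (kernelProduct (v ∘ Fin.succ) (a ∘ Fin.succ) (b ∘ Fin.succ))) := by
    rw [kernelProduct_succ, map_mul, laurentExpansion_kernelProduct (v := v ∘ Fin.succ) hne, map_mul,
      mul_assoc]
    congr 1
    · rw [map_pow, map_inv₀, laurentExpansion_x_self, HahnSeries.ofPowerSeries_X]
      simp [HahnSeries.inv_single]
    · congr 1
      simp only [map_mul, map_prod, laurentExpansion_inv_one_sub_pow,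
        laurentExpansion_inv_one_sub_two_mul, laurentExpansion_inv_sub (hne _),
        laurentExpansion_inv_one_sub_sub (hne _), Fintype.prod_option, Fintype.prod_sum_type, f,
        Option.elim, Sum.elim_inl, Sum.elim_inr]
  rw [CT, hL]
  -- The factor `x⁻ᵃ` shifts degrees, so the constant term is the coefficient of degree `a 0` of the
  -- product of power series.
  have h0 : (0 : ℤ) = (a 0 : ℤ) + -(a 0 : ℤ) := by ring
  rw [h0, HahnSeries.coeff_single_mul_add, one_mul, mul_comm, HahnSeries.C_apply,
    HahnSeries.coeff_single_zero_mul, LaurentSeries.coeff_coe_powerSeries,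
    PowerSeries.coeff_prod_univ, Finset.mul_sum]
  refine Finset.sum_congr rfl fun l _ => ?_
  have := kernelProduct_mul_pow (v ∘ Fin.succ) (a ∘ Fin.succ) (b ∘ Fin.succ)
    (fun j => l (some (some (.inr j)))) (fun j => l (some (some (.inl j))))
  simp only [Function.comp_apply] at this
  rw [← this]
  simp only [Fintype.prod_option, Fintype.prod_sum_type, f, Option.elim, Sum.elim_inl,
    Sum.elim_inr, PowerSeries.coeff_mk]
  push_cast
  simp only [Function.comp_def]
  ring

theorem CT_sum {ι : Type*} (i : σ) (s : Finset ι) (f : ι → RatFun σ) :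
    CT i (∑ l ∈ s, f l) = ∑ l ∈ s, CT i (f l) := by
  simp [CT, map_sum, HahnSeries.coeff_sum]

theorem CT_natCast_mul (i : σ) (c : ℕ) (f : RatFun σ) : CT i (c * f) = c * CT i f := by
  rw [← nsmul_eq_mul, ← nsmul_eq_mul, CT, map_nsmul, HahnSeries.coeff_nsmul]
  rfl

theorem foldl_CT_sum_natCast_mul {ι : Type*} (L : List σ) (s : Finset ι) (c : ι → ℕ)
    (f : ι → RatFun σ) :
    L.foldl (fun g i => CT i g) (∑ l ∈ s, (c l : RatFun σ) * f l) =
      ∑ l ∈ s, (c l : RatFun σ) * L.foldl (fun g i => CT i g) (f l) := by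
  induction L generalizing f with
  | nil => rfl
  | cons i L ih => simp only [List.foldl_cons, CT_sum, CT_natCast_mul, ih]

theorem foldl_CT_kernelProduct {k : ℕ} (v : Fin k → σ) (hv : Function.Injective v)
    (a b : Fin k → ℕ) :
    (List.ofFn v).foldl (fun g i => CT i g) (kernelProduct v a b) = flowCount k a b := by
  induction k with
  | zero => simp [kernelProduct, flowCount]
  | succ k ih =>
    rw [List.ofFn_succ, List.foldl_cons, CT_kernelProduct hv, foldl_CT_sum_natCast_mul, flowCount,
      Nat.cast_sum]
    refine Finset.sum_congr rfl fun l _ => ?_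
    rw [show (fun i : Fin k => v i.succ) = v ∘ Fin.succ from rfl,
      ih (v ∘ Fin.succ) (hv.comp (Fin.succ_injective k)), ← Nat.cast_mul]

theorem iteratedCT_kernelProduct (m : ℕ) (a b : Fin m → ℕ) :
    iteratedCT (kernelProduct (fun i : Fin m => i) a b) = flowCount m a b := by
  rw [iteratedCT, ← foldl_CT_kernelProduct (fun i : Fin m => i) (fun _ _ h => h),
    List.finRange]

end RatFun

/-! ### Integration over product spaces -/

section PiIntegral

variable {ι κ : Type*} [Fintype ι] [Fintype κ] (ν : Measure ℝ) [SigmaFinite ν]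

theorem lintegral_pi_sum {F : (ι ⊕ κ → ℝ) → ℝ≥0∞} (hF : Measurable F) :
    ∫⁻ t, F t ∂Measure.pi (fun _ => ν) =
      ∫⁻ u, ∫⁻ w, F (Sum.elim u w) ∂Measure.pi (fun _ => ν) ∂Measure.pi (fun _ => ν) := by
  have h := measurePreserving_sumPiEquivProdPi_symm (ι := ι) (ι' := κ) (X := fun _ => ℝ)
    (fun _ => ν)
  rw [← h.lintegral_comp hF, lintegral_prod _ (by fun_prop)]
  rfl

theorem lintegral_pi_option {F : (Option ι → ℝ) → ℝ≥0∞} (hF : Measurable F) :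
    ∫⁻ t, F t ∂Measure.pi (fun _ => ν) =
      ∫⁻ w, ∫⁻ s, F (fun o => o.elim s w) ∂ν ∂Measure.pi (fun _ => ν) := by
  have hm : Measurable (MeasurableEquiv.piOptionEquivProd (fun _ : Option ι => ℝ)).symm :=
    MeasurableEquiv.measurable _
  rw [← Measure.pi_map_piOptionEquivProd (ι := ι) (β := fun _ => ℝ) (fun _ => ν),
    lintegral_map hF hm, lintegral_prod _ (by fun_prop)]
  refine lintegral_congr fun w => lintegral_congr fun s => congrArg F ?_
  ext o
  cases o <;> rfl

theorem lintegral_pi_equiv (e : ι ≃ κ) {F : (κ → ℝ) → ℝ≥0∞} (hF : Measurable F) :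
    ∫⁻ t, F t ∂Measure.pi (fun _ => ν) = ∫⁻ t, F (t ∘ e.symm) ∂Measure.pi (fun _ => ν) := by
  have h := measurePreserving_piCongrLeft (α := fun _ : κ => ℝ) (fun _ => ν) e
  rw [← h.lintegral_comp hF]
  refine lintegral_congr fun t => congrArg F ?_
  ext i
  obtain ⟨i, rfl⟩ := e.surjective i
  rw [MeasurableEquiv.coe_piCongrLeft, Equiv.piCongrLeft_apply_apply]
  simp

theorem lintegral_pi_prod {k : ℕ} {g : Fin k → ℝ → ℝ≥0∞} (hg : ∀ j, Measurable (g j)) :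
    ∫⁻ t, ∏ j, g j (t j) ∂Measure.pi (fun _ => ν) = ∏ j, ∫⁻ s, g j s ∂ν := by
  induction k with
  | zero => simp
  | succ k ih =>
    have h := (measurePreserving_piFinSuccAbove (α := fun _ : Fin (k + 1) => ℝ) (fun _ => ν) 0).symm
    rw [← h.lintegral_comp (by fun_prop), lintegral_prod _ (by fun_prop),
      Fin.prod_univ_succ, ← ih fun j => hg j.succ, ← lintegral_mul_const _ (hg 0)]
    refine lintegral_congr fun s => ?_
    rw [← lintegral_const_mul _ (by fun_prop)]
    refine lintegral_congr fun w => ?_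
    rw [Fin.prod_univ_succ]
    rfl

end PiIntegral

/-- Lebesgue measure on the nonnegative orthant. -/
noncomputable def orthantMeasure (ι : Type*) [Fintype ι] : Measure (ι → ℝ) :=
  Measure.pi fun _ => volume.restrict (Ici 0)

instance (ι : Type*) [Fintype ι] : SigmaFinite (orthantMeasure ι) := by
  unfold orthantMeasure
  infer_instance

theorem orthantMeasure_eq_restrict (ι : Type*) [Fintype ι] :
    orthantMeasure ι = volume.restrict {t : ι → ℝ | ∀ i, 0 ≤ t i} := by
  have h : {t : ι → ℝ | ∀ i, 0 ≤ t i} = univ.pi fun _ => Ici 0 := by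
    ext
    simp only [mem_ofPred_eq, mem_univ_pi, mem_Ici]
  rw [h, volume_pi, Measure.restrict_pi_pi]
  rfl

theorem ae_orthantMeasure_nonneg (ι : Type*) [Fintype ι] :
    ∀ᵐ t ∂orthantMeasure ι, ∀ i, 0 ≤ t i := by
  have hm : MeasurableSet {t : ι → ℝ | ∀ i, 0 ≤ t i} := by
    measurability
  rw [orthantMeasure_eq_restrict]
  exact ae_restrict_mem hm

theorem lintegral_halfLine {f : ℝ → ℝ≥0∞} (hf : ∀ s < 0, f s = 0) :
    ∫⁻ s in Ici 0, f s = ∫⁻ s, f s := by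
  rw [← lintegral_indicator measurableSet_Ici]
  refine lintegral_congr fun s => ?_
  by_cases hs : s ∈ Ici (0 : ℝ)
  · rw [indicator_of_mem hs]
  · rw [indicator_of_notMem hs, hf s (by simpa using hs)]

/-! ### The edges of the complete type `C` graph -/

/-- The edges at the first vertex (the loop `none` and, for each other vertex, the positive edge
`some (.inl _)` and the negative edge `some (.inr _)`), followed by all the other edges. -/
def edgeOfSum (k : ℕ) : Option (Fin k ⊕ Fin k) ⊕ CompleteCEdge k → CompleteCEdge (k + 1)
  | .inl none => ⟨(0, 0, true), .inr ⟨rfl, rfl⟩⟩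
  | .inl (some (.inl j)) => ⟨(0, j.succ, true), .inl j.succ_pos⟩
  | .inl (some (.inr j)) => ⟨(0, j.succ, false), .inl j.succ_pos⟩
  | .inr e => ⟨(e.1.1.succ, e.1.2.1.succ, e.1.2.2),
      e.2.imp Fin.succ_lt_succ_iff.2 (And.imp_left (congrArg Fin.succ))⟩

theorem edgeOfSum_bijective (k : ℕ) : Function.Bijective (edgeOfSum k) := by
  constructor
  · rintro ((_ | _ | _) | ⟨⟨_, _, _⟩, _⟩) ((_ | _ | _) | ⟨⟨_, _, _⟩, _⟩) h <;>
      simp_all [edgeOfSum, Fin.ext_iff]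
  · rintro ⟨⟨i, j, s⟩, h⟩
    induction i using Fin.cases with
    | zero =>
      induction j using Fin.cases with
      | zero =>
        have hs : s = true := by simpa using h
        subst hs
        exact ⟨.inl none, rfl⟩
      | succ j =>
        cases s
        · exact ⟨.inl (some (.inr j)), rfl⟩
        · exact ⟨.inl (some (.inl j)), rfl⟩
    | succ i =>
      induction j using Fin.cases with
      | zero => simp at h
      | succ j => exact ⟨.inr ⟨(i, j, s), by simpa using h⟩, rfl⟩

/-- The edges at the first vertex and the edges among the other vertices. -/
noncomputable def edgeEquiv (k : ℕ) :
    Option (Fin k ⊕ Fin k) ⊕ CompleteCEdge k ≃ CompleteCEdge (k + 1) :=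
  Equiv.ofBijective _ (edgeOfSum_bijective k)

/-- The netflow of a real flow on the complete type `C` graph. -/
noncomputable def netflow {k : ℕ} (f : CompleteCEdge k → ℝ) (v : Fin k) : ℝ :=
  ∑ e, ((completeC k).root e v : ℝ) * f e

@[fun_prop]
theorem measurable_netflow {k : ℕ} (v : Fin k) :
    Measurable fun f : CompleteCEdge k → ℝ => netflow f v := by
  unfold netflow
  fun_prop

theorem root_completeC_apply {k : ℕ} (e : CompleteCEdge k) (v : Fin k) :
    (completeC k).root e v = (if v = e.1.1 then 1 else 0) +
      (if e.1.2.2 then 1 else -1) * (if v = e.1.2.1 then 1 else 0) := by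
  obtain ⟨⟨i, j, _ | _⟩, h⟩ := e <;> simp [SignedGraph.root, completeC, Pi.single_apply]
  split_ifs <;> rfl

theorem sum_edges_succ {k : ℕ} (g : CompleteCEdge (k + 1) → ℝ) :
    ∑ e, g e = g (edgeOfSum k (.inl none)) +
      ((∑ j, g (edgeOfSum k (.inl (some (.inl j))))) +
        ∑ j, g (edgeOfSum k (.inl (some (.inr j))))) + ∑ e, g (edgeOfSum k (.inr e)) := by
  rw [← (edgeEquiv k).sum_comp, Fintype.sum_sum_type, Fintype.sum_option, Fintype.sum_sum_type]
  rfl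

/-- No edge enters the first vertex with a negative sign; hence the kernel there is evaluated at a
sum of nonnegative terms and `twoSidedKernel_sum` applies. -/
theorem netflow_zero {k : ℕ} (f : CompleteCEdge (k + 1) → ℝ) :
    netflow f 0 = 2 * f (edgeOfSum k (.inl none)) +
      ((∑ j, f (edgeOfSum k (.inl (some (.inl j))))) +
        ∑ j, f (edgeOfSum k (.inl (some (.inr j))))) := by
  simp only [netflow, sum_edges_succ, root_completeC_apply, edgeOfSum, (Fin.succ_ne_zero _).symm,
    if_true, if_false]
  norm_num

theorem netflow_succ {k : ℕ} (f : CompleteCEdge (k + 1) → ℝ) (v : Fin k) :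
    netflow f v.succ = netflow (fun e => f (edgeOfSum k (.inr e))) v +
      f (edgeOfSum k (.inl (some (.inl v)))) - f (edgeOfSum k (.inl (some (.inr v)))) := by
  have hl : (completeC (k + 1)).root (edgeOfSum k (.inl none)) v.succ = 0 := by
    simp [root_completeC_apply, edgeOfSum]
  have hp : ∀ j, (completeC (k + 1)).root (edgeOfSum k (.inl (some (.inl j)))) v.succ =
      if v = j then 1 else 0 := by
    simp [root_completeC_apply, edgeOfSum]
  have hn : ∀ j, (completeC (k + 1)).root (edgeOfSum k (.inl (some (.inr j)))) v.succ =
      if v = j then -1 else 0 := by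
    simp [root_completeC_apply, edgeOfSum]
  have he : ∀ e, (completeC (k + 1)).root (edgeOfSum k (.inr e)) v.succ =
      (completeC k).root e v := by
    simp [root_completeC_apply, edgeOfSum]
  simp only [netflow, sum_edges_succ, hl, hp, hn, he]
  simp
  ring

/-! ### The integral recursion -/

/-- The integral over all nonnegative flows of a product of kernels of the netflows. -/
noncomputable def flowIntegral (k : ℕ) (a b : Fin k → ℕ) : ℝ≥0∞ :=
  ∫⁻ f, ∏ j, twoSidedKernel (a j) (b j) (netflow f j) ∂orthantMeasure (CompleteCEdge k)

theorem lintegral_orthant_edges {k : ℕ} {F : (CompleteCEdge (k + 1) → ℝ) → ℝ≥0∞}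
    (hF : Measurable F) :
    ∫⁻ f, F f ∂orthantMeasure (CompleteCEdge (k + 1)) =
      ∫⁻ w, ∫⁻ f, F (Sum.elim w f ∘ (edgeEquiv k).symm) ∂orthantMeasure (CompleteCEdge k)
        ∂orthantMeasure (Option (Fin k ⊕ Fin k)) := by
  unfold orthantMeasure
  rw [lintegral_pi_equiv _ (edgeEquiv k) hF, lintegral_pi_sum _ (by fun_prop)]

theorem sum_elim_comp_edgeEquiv_symm {k : ℕ} (w : Option (Fin k ⊕ Fin k) → ℝ)
    (f : CompleteCEdge k → ℝ) (o : Option (Fin k ⊕ Fin k) ⊕ CompleteCEdge k) :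
    (Sum.elim w f ∘ (edgeEquiv k).symm) (edgeOfSum k o) = Sum.elim w f o := by
  rw [show edgeOfSum k o = edgeEquiv k o from rfl]
  simp

/-- The integral over the edges at one vertex factors: the loop gives `2 ^ c`, and each other vertex
absorbs its negative and then its positive edge. -/
theorem lintegral_orthant_kernels {k : ℕ} (a b α β : Fin k → ℕ) (c : ℕ) (y : Fin k → ℝ) :
    ∫⁻ w, (gammaKernel c (2 * w none) *
        ((∏ j, gammaKernel (α j) (w (some (.inl j)))) *
          ∏ j, gammaKernel (β j) (w (some (.inr j))))) *
        ∏ j, twoSidedKernel (a j) (b j) (y j + w (some (.inl j)) - w (some (.inr j)))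
      ∂orthantMeasure (Option (Fin k ⊕ Fin k)) =
    2 ^ c * ∏ j, twoSidedKernel (a j + β j + 1) (b j + α j + 1) (y j) := by
  unfold orthantMeasure
  rw [lintegral_pi_option _ (by fun_prop)]
  simp only [Option.elim]
  have h1 : ∀ w : Fin k ⊕ Fin k → ℝ,
      ∫⁻ s in Ici (0 : ℝ), (gammaKernel c (2 * s) *
        ((∏ j, gammaKernel (α j) (w (.inl j))) * ∏ j, gammaKernel (β j) (w (.inr j)))) *
        ∏ j, twoSidedKernel (a j) (b j) (y j + w (.inl j) - w (.inr j)) =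
      2 ^ c * ((∏ j, gammaKernel (α j) (w (.inl j))) * ∏ j, (gammaKernel (β j) (w (.inr j)) *
        twoSidedKernel (a j) (b j) (y j + w (.inl j) - w (.inr j)))) := by
    intro w
    simp_rw [mul_assoc]
    rw [lintegral_mul_const _ (by fun_prop), lintegral_halfLine, lintegral_gammaKernel_two_mul,
      Finset.prod_mul_distrib]
    exact fun s hs => gammaKernel_of_neg _ (by linarith)
  simp_rw [h1]
  rw [lintegral_const_mul _ (by fun_prop), lintegral_pi_sum _ (by fun_prop)]
  simp only [Sum.elim_inl, Sum.elim_inr]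
  congr 1
  have h2 : ∀ p : Fin k → ℝ,
      ∫⁻ m, (∏ j, gammaKernel (α j) (p j)) * ∏ j, (gammaKernel (β j) (m j) *
          twoSidedKernel (a j) (b j) (y j + p j - m j))
        ∂Measure.pi (fun _ => volume.restrict (Ici 0)) =
      ∏ j, (gammaKernel (α j) (p j) * twoSidedKernel (a j + β j + 1) (b j) (y j + p j)) := by
    intro p
    rw [lintegral_const_mul _ (by fun_prop), Finset.prod_mul_distrib,
      lintegral_pi_prod _ (g := fun j m => gammaKernel (β j) m *
        twoSidedKernel (a j) (b j) (y j + p j - m)) (by fun_prop)]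
    congr 1
    refine Finset.prod_congr rfl fun j _ => ?_
    rw [lintegral_halfLine, lintegral_gammaKernel_mul_twoSidedKernel_sub]
    intro s hs
    rw [gammaKernel_of_neg _ hs, zero_mul]
  simp_rw [h2]
  rw [lintegral_pi_prod _ (g := fun j p => gammaKernel (α j) p *
    twoSidedKernel (a j + β j + 1) (b j) (y j + p)) (by fun_prop)]
  refine Finset.prod_congr rfl fun j _ => ?_
  rw [lintegral_halfLine, lintegral_gammaKernel_mul_twoSidedKernel_add]
  intro s hs
  rw [gammaKernel_of_neg _ hs, zero_mul]

theorem flowIntegral_succ {k : ℕ} (a b : Fin (k + 1) → ℕ) :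
    flowIntegral (k + 1) a b =
      ∑ l ∈ Finset.piAntidiag (Finset.univ : Finset (Option (Option (Fin k ⊕ Fin k)))) (a 0),
        ((l none + b 0).choose (l none) : ℝ≥0∞) * (2 ^ l (some none) *
          flowIntegral k (fun j => a j.succ + l (some (some (.inr j))) + 1)
            (fun j => b j.succ + l (some (some (.inl j))) + 1)) := by
  rw [flowIntegral, lintegral_orthant_edges (by fun_prop)]
  simp only [Fin.prod_univ_succ, netflow_zero, netflow_succ, sum_elim_comp_edgeEquiv_symm,
    Sum.elim_inl, Sum.elim_inr]
  -- The multinomial expansion needs nonnegative flows, which hold only almost everywhere for the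
  -- orthant measure.
  have h : ∀ᵐ w ∂orthantMeasure (Option (Fin k ⊕ Fin k)),
      ∫⁻ f, twoSidedKernel (a 0) (b 0) (2 * w none + ((∑ j, w (some (.inl j))) +
          ∑ j, w (some (.inr j)))) * ∏ j : Fin k, twoSidedKernel (a j.succ) (b j.succ)
            (netflow f j + w (some (.inl j)) - w (some (.inr j)))
          ∂orthantMeasure (CompleteCEdge k) =
      ∑ l ∈ Finset.piAntidiag (Finset.univ : Finset (Option (Option (Fin k ⊕ Fin k)))) (a 0),
        ((l none + b 0).choose (l none) : ℝ≥0∞) *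
          ∫⁻ f, (gammaKernel (l (some none)) (2 * w none) *
            ((∏ j, gammaKernel (l (some (some (.inl j)))) (w (some (.inl j)))) *
              ∏ j, gammaKernel (l (some (some (.inr j)))) (w (some (.inr j))))) *
            ∏ j : Fin k, twoSidedKernel (a j.succ) (b j.succ)
              (netflow f j + w (some (.inl j)) - w (some (.inr j)))
            ∂orthantMeasure (CompleteCEdge k) := by
    filter_upwards [ae_orthantMeasure_nonneg (Option (Fin k ⊕ Fin k))] with w hw
    have h1 := twoSidedKernel_sum (a 0) (b 0)
      (fun o : Option (Fin k ⊕ Fin k) => o.elim (2 * w none) fun i => w (some i))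
      (by rintro (_ | i) <;> simp [hw])
    simp only [Fintype.sum_option, Fintype.sum_sum_type, Fintype.prod_option,
      Fintype.prod_sum_type, Option.elim] at h1
    rw [h1, lintegral_const_mul _ (by fun_prop), Finset.sum_mul]
    refine Finset.sum_congr rfl fun l _ => ?_
    rw [lintegral_const_mul _ (by fun_prop), mul_assoc]
  rw [lintegral_congr_ae h, lintegral_finsetSum _ fun l _ => by fun_prop]
  refine Finset.sum_congr rfl fun l _ => ?_
  rw [lintegral_const_mul _ (by fun_prop), lintegral_lintegral_swap (by fun_prop), flowIntegral,
    ← lintegral_const_mul (2 ^ l (some none)) (by fun_prop)]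
  congr 1
  refine lintegral_congr fun f => ?_
  exact lintegral_orthant_kernels (fun j => a j.succ) (fun j => b j.succ)
    (fun j => l (some (some (.inl j)))) (fun j => l (some (some (.inr j)))) _ (netflow f)

theorem flowIntegral_eq_flowCount (k : ℕ) (a b : Fin k → ℕ) :
    flowIntegral k a b = flowCount k a b := by
  induction k with
  | zero =>
    have : IsEmpty (CompleteCEdge 0) := ⟨fun e => e.1.1.elim0⟩
    simp [flowIntegral, flowCount, orthantMeasure]
  | succ k ih =>
    rw [flowIntegral_succ, flowCount]
    push_cast
    refine Finset.sum_congr rfl fun l _ => ?_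
    rw [ih, mul_assoc]

/-! ### Normalized volumes through unimodular coordinates -/

theorem volume_image_equivFun_eq {E κ : Type*} [NormedAddCommGroup E] [InnerProductSpace ℝ E]
    [FiniteDimensional ℝ E] [MeasurableSpace E] [BorelSpace E] [Fintype κ]
    (b : Module.Basis κ ℝ E) {L : Submodule ℤ E} (hL : L = Submodule.span ℤ (range b))
    {S : Set E} (hS : MeasurableSet S) :
    volume.real S / ZLattice.covolume L = volume.real (b.equivFun '' S) := by
  subst hL
  have hb : (b.restrictScalars ℤ).ofZLatticeBasis ℝ (Submodule.span ℤ (range b)) = b := by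
    ext i
    rw [Module.Basis.ofZLatticeBasis_apply, Module.Basis.restrictScalars_apply]
  have h := ZLattice.volume_image_eq_volume_div_covolume' (Submodule.span ℤ (range b))
    (b.restrictScalars ℤ) hS.nullMeasurableSet
  rw [hb] at h
  rw [measureReal_def, measureReal_def, h, ENNReal.toReal_div,
    ENNReal.toReal_ofReal (ZLattice.covolume_pos _ volume).le]

/-- The normalized volume of the image of a full-dimensional set `Q` under an affine map which
preserves integrality and has some of the coordinates as an inverse. -/
theorem normalizedVolume_image {ι κ : Type*} [Fintype ι] [Fintype κ]
    (Φ : (κ → ℝ) →ₗ[ℝ] EuclideanSpace ℝ ι) (c : EuclideanSpace ℝ ι) (s : κ → ι)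
    (hs : ∀ q i, Φ q (s i) = q i)
    (hΦ : ∀ q : κ → ℝ, (∀ i, q i ∈ range ((↑) : ℤ → ℝ)) → ∀ j, Φ q j ∈ range ((↑) : ℤ → ℝ))
    {Q : Set (κ → ℝ)} (hQ : (interior Q).Nonempty) (hQm : MeasurableSet Q) :
    normalizedVolume ((fun q => Φ q + c) '' Q) = (Fintype.card κ)! * volume.real Q := by
  set P := (fun q => Φ q + c) '' Q with hP
  have hinj : Function.Injective Φ := fun q r h => by
    ext i
    rw [← hs q, h, hs]
  have hspan : LinearMap.range Φ = vectorSpan ℝ P := by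
    have h1 : P = (Φ.toAffineMap + AffineMap.const ℝ (κ → ℝ) c) '' Q := rfl
    have h2 : vectorSpan ℝ Q = ⊤ := AffineSubspace.vectorSpan_eq_top_of_affineSpan_eq_top ℝ _ _
      (eq_top_iff.2 (by
        rw [← isOpen_interior.affineSpan_eq_top hQ]
        exact affineSpan_mono ℝ interior_subset))
    rw [h1, ← AffineMap.map_vectorSpan, h2]
    simp
  let Ψ : (κ → ℝ) ≃ₗ[ℝ] vectorSpan ℝ P :=
    (LinearEquiv.ofInjective Φ hinj).trans (LinearEquiv.ofEq _ _ hspan)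
  have hΨ : ∀ q, (Ψ q : EuclideanSpace ℝ ι) = Φ q := fun q => rfl
  -- The images of the unit vectors form a lattice basis: `hΦ` makes them integral, and reading off
  -- the coordinates `s` shows that they generate.
  let b : Module.Basis κ ℝ (vectorSpan ℝ P) := Module.Basis.ofEquivFun Ψ.symm
  have hL : directionLattice P = Submodule.span ℤ (range b) := by
    ext w
    obtain ⟨q, rfl⟩ := Ψ.surjective w
    have h1 : Ψ q ∈ directionLattice P ↔ ∀ j, Φ q j ∈ range ((↑) : ℤ → ℝ) := by
      rw [directionLattice, Submodule.mem_comap,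
        ← OrthonormalBasis.coe_toBasis, Module.Basis.mem_span_iff_repr_mem]
      rfl
    have h2 : Ψ q ∈ Submodule.span ℤ (range b) ↔ ∀ i, q i ∈ range ((↑) : ℤ → ℝ) := by
      rw [Module.Basis.mem_span_iff_repr_mem]
      refine forall_congr' fun i => ?_
      rw [← Module.Basis.equivFun_apply, Module.Basis.equivFun_ofEquivFun]
      simp
    rw [h1, h2]
    exact ⟨fun h i => hs q i ▸ h (s i), hΦ q⟩
  have hne : P.Nonempty := (hQ.mono interior_subset).image _
  obtain ⟨q₀, -, hq₀⟩ := hne.some_mem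
  have himage : b.equivFun '' {v : vectorSpan ℝ P | (v : EuclideanSpace ℝ ι) + hne.some ∈ P} =
      (fun q => q + q₀) ⁻¹' Q := by
    rw [Module.Basis.equivFun_ofEquivFun, LinearEquiv.image_eq_preimage_symm]
    ext q
    simp only [mem_preimage, mem_ofPred_eq, LinearEquiv.symm_symm, hΨ, ← hq₀]
    rw [← add_assoc, ← map_add]
    refine ⟨?_, fun h => ⟨_, h, rfl⟩⟩
    rintro ⟨r, hr, h⟩
    rwa [← hinj (add_right_cancel h)]
  have hmeas : MeasurableSet {v : vectorSpan ℝ P | (v : EuclideanSpace ℝ ι) + hne.some ∈ P} := by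
    have h1 : {v : vectorSpan ℝ P | (v : EuclideanSpace ℝ ι) + hne.some ∈ P} =
        Ψ.symm ⁻¹' ((fun q => q + q₀) ⁻¹' Q) := by
      rw [← himage, Module.Basis.equivFun_ofEquivFun, preimage_image_eq _ Ψ.symm.injective]
    rw [h1]
    exact (LinearMap.continuous_of_finiteDimensional Ψ.symm.toLinearMap).measurable
      (hQm.preimage (measurable_add_const q₀))
  rw [normalizedVolume, dif_pos hne, volume_image_equivFun_eq b hL hmeas, himage,
    ← Ψ.finrank_eq, Module.finrank_fintype_fun_eq_card, measureReal_def,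
    measure_preimage_add_right, measureReal_def]

/-! ### Volumes of truncated cones -/

theorem setLIntegral_Ici_exp_neg (c : ℝ) :
    ∫⁻ t in Ici c, ENNReal.ofReal (Real.exp (-t)) = ENNReal.ofReal (Real.exp (-c)) := by
  rw [setLIntegral_congr Ioi_ae_eq_Ici.symm,
    ← ofReal_integral_eq_lintegral_ofReal (integrableOn_exp_neg_Ioi c)
      (Filter.Eventually.of_forall fun t => (Real.exp_pos _).le), integral_exp_neg_Ioi]

open scoped Pointwise in
/-- The exponential integral of a linear form over a cone is a factorial multiple of the volume
cut off by the linear form. -/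
theorem lintegral_cone_exp_neg {κ : Type*} [Fintype κ] {C : Set (κ → ℝ)} (hC : MeasurableSet C)
    (hCsmul : ∀ t : ℝ, 0 < t → ∀ q ∈ C, t • q ∈ C) (ℓ : (κ → ℝ) →ₗ[ℝ] ℝ) (hℓ : ∀ q ∈ C, 0 ≤ ℓ q) :
    ∫⁻ q in C, ENNReal.ofReal (Real.exp (-ℓ q)) =
      (Fintype.card κ)! * volume (C ∩ {q | ℓ q ≤ 1}) := by
  have hℓm : Measurable ℓ := (LinearMap.continuous_of_finiteDimensional ℓ).measurable
  -- Layer cake: `exp (-ℓ)` is the integral of `exp (-t)` over `t ≥ ℓ`. After swapping the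
  -- integrals, homogeneity of the cone gives slices of volume proportional to `t ^ d`.
  have h1 : ∀ q ∈ C, ENNReal.ofReal (Real.exp (-ℓ q)) =
      ∫⁻ t in Ioi (0 : ℝ), {p : (κ → ℝ) × ℝ | ℓ p.1 ≤ p.2}.indicator
        (fun p => ENNReal.ofReal (Real.exp (-p.2))) (q, t) := by
    intro q hq
    rw [← setLIntegral_Ici_exp_neg, setLIntegral_congr Ioi_ae_eq_Ici,
      ← lintegral_indicator measurableSet_Ici, ← lintegral_indicator measurableSet_Ici]
    refine lintegral_congr fun t => ?_
    simp only [indicator_apply, mem_Ici, mem_ofPred_eq]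
    by_cases ht : ℓ q ≤ t
    · rw [if_pos ht, if_pos ((hℓ q hq).trans ht)]
    · simp [ht]
  have hm : Measurable ({p : (κ → ℝ) × ℝ | ℓ p.1 ≤ p.2}.indicator
      fun p => ENNReal.ofReal (Real.exp (-p.2))) :=
    Measurable.indicator (by fun_prop) (measurableSet_le (by fun_prop) (by fun_prop))
  rw [setLIntegral_congr_fun hC h1, lintegral_lintegral_swap
    (f := fun q t => {p : (κ → ℝ) × ℝ | ℓ p.1 ≤ p.2}.indicator
      (fun p => ENNReal.ofReal (Real.exp (-p.2))) (q, t)) hm.aemeasurable]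
  have h2 : ∀ t ∈ Ioi (0 : ℝ), ∫⁻ q in C, {p : (κ → ℝ) × ℝ | ℓ p.1 ≤ p.2}.indicator
        (fun p => ENNReal.ofReal (Real.exp (-p.2))) (q, t) =
      ENNReal.ofReal (t ^ Fintype.card κ * Real.exp (-t)) * volume (C ∩ {q | ℓ q ≤ 1}) := by
    intro t ht
    have ht : 0 < t := ht
    have hset : C ∩ {q | ℓ q ≤ t} = t • (C ∩ {q | ℓ q ≤ 1}) := by
      ext q
      rw [mem_smul_set_iff_inv_smul_mem₀ ht.ne']
      simp only [mem_inter_iff, mem_ofPred_eq, map_smul, smul_eq_mul]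
      rw [inv_mul_le_iff₀ ht, mul_one]
      refine and_congr_left fun _ => ⟨hCsmul _ (inv_pos.2 ht) q, fun h => ?_⟩
      simpa [smul_smul, ht.ne'] using hCsmul t ht _ h
    have hind : ∀ q : κ → ℝ, {p : (κ → ℝ) × ℝ | ℓ p.1 ≤ p.2}.indicator
        (fun p => ENNReal.ofReal (Real.exp (-p.2))) (q, t) =
        {q | ℓ q ≤ t}.indicator (fun _ => ENNReal.ofReal (Real.exp (-t))) q := fun q => rfl
    have hmt : MeasurableSet {q | ℓ q ≤ t} := measurableSet_le hℓm measurable_const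
    simp_rw [hind]
    rw [lintegral_indicator hmt, setLIntegral_const, Measure.restrict_apply hmt, inter_comm, hset,
      Measure.addHaar_smul, Module.finrank_fintype_fun_eq_card, abs_of_pos (by positivity),
      ← mul_assoc, ← ENNReal.ofReal_mul (by positivity), mul_comm (Real.exp _)]
  rw [setLIntegral_congr_fun measurableSet_Ioi h2, lintegral_mul_const _ (by fun_prop),
    lintegral_pow_mul_exp_neg]

/-! ### Unimodular coordinates on `CRYC n` -/

section Coordinates

variable {n : ℕ}

/-- The netflow as a linear map. -/
noncomputable def netflowLinear (v : Fin n) : (CompleteCEdge n → ℝ) →ₗ[ℝ] ℝ :=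
  ∑ e, ((completeC n).root e v : ℝ) • LinearMap.proj e

theorem netflowLinear_apply (v : Fin n) (f : CompleteCEdge n → ℝ) :
    netflowLinear v f = netflow f v := by
  simp [netflowLinear, netflow]

/-- The entries of a root sum to `2` for a positive edge and to `0` for a negative one. -/
theorem sum_netflow (f : CompleteCEdge n → ℝ) :
    ∑ v, netflow f v = 2 * ∑ e : CompleteCEdge n, if e.1.2.2 then f e else 0 := by
  unfold netflow
  rw [Finset.sum_comm, Finset.mul_sum]
  refine Finset.sum_congr rfl fun e _ => ?_
  rw [← Finset.sum_mul]
  simp only [root_completeC_apply]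
  push_cast
  rw [Finset.sum_add_distrib, ← Finset.mul_sum]
  split_ifs <;> norm_num

theorem mem_CRYC_iff (f : EuclideanSpace ℝ (CompleteCEdge (n + 1))) :
    f ∈ CRYC n ↔ (∀ e, 0 ≤ f e) ∧ netflow f 0 = 2 ∧ ∀ v : Fin n, netflow f v.succ = 0 := by
  refine and_congr_right fun _ => ?_
  have h : ((completeC (n + 1)).rootMatrix.map (Int.cast : ℤ → ℝ)).mulVec (fun e => f e) =
      netflow f := rfl
  rw [h, funext_iff, Fin.forall_fin_succ]
  simp

/-- The total flow on the positive edges, when `q` consists of the flow on the edges among the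
last `n` vertices and the flow on the positive edges from the first vertex to them. -/
noncomputable def positiveFlow (n : ℕ) : (CompleteCEdge n ⊕ Fin n → ℝ) →ₗ[ℝ] ℝ :=
  (∑ j, LinearMap.proj (Sum.inr j)) +
    ∑ e : CompleteCEdge n, if e.1.2.2 then LinearMap.proj (Sum.inl e) else 0

theorem positiveFlow_apply (q : CompleteCEdge n ⊕ Fin n → ℝ) :
    positiveFlow n q =
      (∑ j, q (.inr j)) + ∑ e : CompleteCEdge n, if e.1.2.2 then q (.inl e) else 0 := by
  simp only [positiveFlow, LinearMap.add_apply, LinearMap.sum_apply, LinearMap.proj_apply]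
  congr 1
  refine Finset.sum_congr rfl fun e _ => ?_
  split_ifs <;> rfl

/-- This form of `ℓ` splits over the vertices and explains the decay rate `1/2` in `gammaKernel`. -/
theorem two_mul_positiveFlow (q : CompleteCEdge n ⊕ Fin n → ℝ) :
    2 * positiveFlow n q =
      (∑ j, q (.inr j)) + ∑ j, (netflow (fun e => q (.inl e)) j + q (.inr j)) := by
  rw [positiveFlow_apply, mul_add, ← sum_netflow, Finset.sum_add_distrib]
  ring

theorem positiveFlow_nonneg {q : CompleteCEdge n ⊕ Fin n → ℝ} (hq : ∀ i, 0 ≤ q i) :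
    0 ≤ positiveFlow n q := by
  rw [positiveFlow_apply]
  refine add_nonneg (Finset.sum_nonneg fun j _ => hq _) (Finset.sum_nonneg fun e _ => ?_)
  split_ifs
  exacts [hq _, le_rfl]

theorem netflow_smul (t : ℝ) (q : CompleteCEdge n ⊕ Fin n → ℝ) (j : Fin n) :
    netflow (fun e => (t • q) (.inl e)) j = t * netflow (fun e => q (.inl e)) j := by
  simp only [netflow, Pi.smul_apply, smul_eq_mul, Finset.mul_sum]
  exact Finset.sum_congr rfl fun e _ => by ring

/-- The linear part of the flow determined by the free coordinates, by edges. -/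
noncomputable def flowCoordinate (n : ℕ) :
    Option (Fin n ⊕ Fin n) ⊕ CompleteCEdge n → (CompleteCEdge n ⊕ Fin n → ℝ) →ₗ[ℝ] ℝ
  -- Total netflow `2` forces total positive flow `1`, so the loop carries `1 - positiveFlow`; the
  -- constant is added separately in `CRYC_eq_image`.
  | .inl none => -positiveFlow n
  | .inl (some (.inl j)) => LinearMap.proj (Sum.inr j)
  | .inl (some (.inr j)) =>
      netflowLinear j ∘ₗ LinearMap.funLeft ℝ ℝ Sum.inl + LinearMap.proj (Sum.inr j)
  | .inr e => LinearMap.proj (Sum.inl e)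

/-- The linear part of the flow determined by the free coordinates. -/
noncomputable def flowOfCoordinates (n : ℕ) :
    (CompleteCEdge n ⊕ Fin n → ℝ) →ₗ[ℝ] EuclideanSpace ℝ (CompleteCEdge (n + 1)) :=
  (WithLp.linearEquiv 2 ℝ (CompleteCEdge (n + 1) → ℝ)).symm.toLinearMap ∘ₗ
    LinearMap.pi fun e => flowCoordinate n ((edgeEquiv n).symm e)

theorem flowOfCoordinates_apply (q : CompleteCEdge n ⊕ Fin n → ℝ)
    (o : Option (Fin n ⊕ Fin n) ⊕ CompleteCEdge n) :
    flowOfCoordinates n q (edgeOfSum n o) = flowCoordinate n o q := by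
  rw [show edgeOfSum n o = edgeEquiv n o from rfl]
  simp [flowOfCoordinates]

/-- The cone of nonnegative flows in the free coordinates. -/
def flowCone (n : ℕ) : Set (CompleteCEdge n ⊕ Fin n → ℝ) :=
  {q | (∀ i, 0 ≤ q i) ∧ ∀ j, 0 ≤ netflow (fun e => q (.inl e)) j + q (.inr j)}

theorem measurableSet_flowCone : MeasurableSet (flowCone n) := by
  have h : flowCone n = (⋂ i, {q | 0 ≤ q i}) ∩
      ⋂ j, {q | 0 ≤ netflow (fun e => q (.inl e)) j + q (.inr j)} := by
    ext q
    simp [flowCone]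
  rw [h]
  refine (MeasurableSet.iInter fun i => ?_).inter (MeasurableSet.iInter fun j => ?_)
  · exact measurableSet_le (by fun_prop) (by fun_prop)
  · exact measurableSet_le (by fun_prop) (by fun_prop)

theorem CRYC_eq_image :
    CRYC n = (fun q => flowOfCoordinates n q +
      EuclideanSpace.single (edgeOfSum n (.inl none)) (1 : ℝ)) ''
        (flowCone n ∩ {q | positiveFlow n q ≤ 1}) := by
  have hval : ∀ (q : CompleteCEdge n ⊕ Fin n → ℝ) (o : Option (Fin n ⊕ Fin n) ⊕ CompleteCEdge n),
      (flowOfCoordinates n q + EuclideanSpace.single (edgeOfSum n (.inl none)) (1 : ℝ))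
        (edgeOfSum n o) = flowCoordinate n o q + if o = .inl none then 1 else 0 := by
    intro q o
    rw [PiLp.add_apply, flowOfCoordinates_apply, PiLp.single_apply]
    simp only [(edgeOfSum_bijective n).injective.eq_iff]
  have hneg : ∀ (q : CompleteCEdge n ⊕ Fin n → ℝ) (j : Fin n),
      flowCoordinate n (.inl (some (.inr j))) q =
        netflow (fun e => q (.inl e)) j + q (.inr j) := fun q j => by
    simp [flowCoordinate, netflowLinear_apply, LinearMap.funLeft, Function.comp_def]
  ext f
  rw [mem_CRYC_iff, netflow_zero]
  simp only [netflow_succ]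
  constructor
  · rintro ⟨hf, h0, hv⟩
    let q : CompleteCEdge n ⊕ Fin n → ℝ := Sum.elim (fun e => f (edgeOfSum n (.inr e)))
      fun j => f (edgeOfSum n (.inl (some (.inl j))))
    have hm : ∀ j, netflow (fun e => q (.inl e)) j + q (.inr j) =
        f (edgeOfSum n (.inl (some (.inr j)))) := fun j => sub_eq_zero.1 (hv j)
    have hl : positiveFlow n q = 1 - f (edgeOfSum n (.inl none)) := by
      have := two_mul_positiveFlow q
      simp only [hm] at this
      simp only [q, Sum.elim_inr] at this ⊢
      linarith
    refine ⟨q, ⟨⟨?_, fun j => (hm j).symm ▸ hf _⟩, ?_⟩, ?_⟩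
    · rintro (e | j)
      exacts [hf _, hf _]
    · simp only [mem_ofPred_eq, hl]
      linarith [hf (edgeOfSum n (.inl none))]
    · ext e
      obtain ⟨o, rfl⟩ := (edgeOfSum_bijective n).surjective e
      refine (hval q o).trans ?_
      obtain ((_ | j | j) | e) := o
      · simp [flowCoordinate, hl]
      · simp [flowCoordinate, q]
      · simp [hneg, hm]
      · simp [flowCoordinate, q]
  · rintro ⟨q, ⟨⟨hq, hj⟩, hl⟩, rfl⟩
    simp only [hval, hneg]
    have h2 := two_mul_positiveFlow q
    refine ⟨fun e => ?_, ?_, fun v => ?_⟩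
    · obtain ⟨o, rfl⟩ := (edgeOfSum_bijective n).surjective e
      rw [hval]
      obtain ((_ | j | j) | e) := o
      · simpa [flowCoordinate] using hl
      · simpa [flowCoordinate] using hq _
      · simpa [hneg] using hj j
      · simpa [flowCoordinate] using hq _
    · simp [flowCoordinate] at h2 ⊢
      linarith
    · simp [flowCoordinate]

theorem interior_flowCone_inter_nonempty :
    (interior (flowCone n ∩ {q | positiveFlow n q ≤ 1})).Nonempty := by
  let U : Set (CompleteCEdge n ⊕ Fin n → ℝ) := ((⋂ i, {q | 0 < q i}) ∩
    ⋂ j, {q | 0 < netflow (fun e => q (.inl e)) j + q (.inr j)}) ∩ {q | positiveFlow n q < 1}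
  have hU : IsOpen U := by
    refine (IsOpen.inter ?_ ?_).inter ?_
    · exact isOpen_iInter_of_finite fun i => isOpen_lt (by fun_prop) (by fun_prop)
    · refine isOpen_iInter_of_finite fun j => isOpen_lt (by fun_prop) ?_
      unfold netflow
      fun_prop
    · exact isOpen_lt (LinearMap.continuous_of_finiteDimensional (positiveFlow n))
        continuous_const
  have hUQ : U ⊆ flowCone n ∩ {q | positiveFlow n q ≤ 1} := by
    rintro q ⟨⟨h1, h2⟩, h3⟩
    simp only [mem_iInter, mem_ofPred_eq] at h1 h2 h3
    exact ⟨⟨fun i => (h1 i).le, fun j => (h2 j).le⟩, h3.le⟩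
  refine Set.Nonempty.mono (interior_maximal hUQ hU) ?_
  -- Unit flow on the inner edges, with `p_j` large enough to make every `m_j` positive; scaling
  -- then brings `positiveFlow` below `1`.
  let r : CompleteCEdge n ⊕ Fin n → ℝ :=
    Sum.elim (fun _ => 1) fun j => 1 + |netflow (fun _ => 1) j|
  have hr : ∀ i, 0 < r i := by
    rintro (e | j) <;> simp only [r, Sum.elim_inl, Sum.elim_inr] <;> positivity
  have hpos := positiveFlow_nonneg fun i => (hr i).le
  set t := (1 + positiveFlow n r)⁻¹ with ht
  have ht0 : 0 < t := by positivity
  refine ⟨t • r, ⟨?_, ?_⟩, ?_⟩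
  · simp only [mem_iInter, mem_ofPred_eq]
    exact fun i => mul_pos ht0 (hr i)
  · simp only [mem_iInter, mem_ofPred_eq]
    intro j
    rw [netflow_smul, Pi.smul_apply, smul_eq_mul, ← mul_add]
    refine mul_pos ht0 ?_
    simp only [r, Sum.elim_inl, Sum.elim_inr]
    linarith [neg_abs_le (netflow (fun _ : CompleteCEdge n => (1 : ℝ)) j)]
  · simp only [mem_ofPred_eq, map_smul, smul_eq_mul, ht]
    rw [inv_mul_lt_iff₀ (by positivity)]
    linarith

theorem flowCoordinate_mem_range_intCast {q : CompleteCEdge n ⊕ Fin n → ℝ}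
    (hq : ∀ i, q i ∈ range ((↑) : ℤ → ℝ)) (o : Option (Fin n ⊕ Fin n) ⊕ CompleteCEdge n) :
    flowCoordinate n o q ∈ range ((↑) : ℤ → ℝ) := by
  change ∀ i, q i ∈ (Int.castRingHom ℝ).range at hq
  change _ ∈ (Int.castRingHom ℝ).range
  obtain ((_ | j | j) | e) := o
  · refine neg_mem ?_
    rw [positiveFlow_apply]
    refine add_mem (sum_mem fun j _ => hq _) (sum_mem fun e _ => ?_)
    split_ifs
    exacts [hq _, zero_mem _]
  · exact hq _
  · refine add_mem ?_ (hq _)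
    rw [LinearMap.comp_apply, netflowLinear_apply]
    exact sum_mem fun e _ => mul_mem ⟨_, rfl⟩ (hq _)
  · exact hq _

/-! ### From the normalized volume to the flow integral -/

theorem normalizedVolume_CRYC_eq_volume :
    normalizedVolume (CRYC n) = (Fintype.card (CompleteCEdge n ⊕ Fin n))! *
      volume.real (flowCone n ∩ {q | positiveFlow n q ≤ 1}) := by
  rw [CRYC_eq_image]
  refine normalizedVolume_image (flowOfCoordinates n) _
    (Sum.elim (fun e => edgeOfSum n (.inr e)) fun j => edgeOfSum n (.inl (some (.inl j))))
    ?_ ?_ interior_flowCone_inter_nonempty ?_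
  · rintro q (e | j)
    · exact flowOfCoordinates_apply q (.inr e)
    · exact flowOfCoordinates_apply q (.inl (some (.inl j)))
  · intro q hq e
    obtain ⟨o, rfl⟩ := (edgeOfSum_bijective n).surjective e
    rw [flowOfCoordinates_apply]
    exact flowCoordinate_mem_range_intCast hq o
  · refine measurableSet_flowCone.inter (measurableSet_le ?_ measurable_const)
    exact (LinearMap.continuous_of_finiteDimensional (positiveFlow n)).measurable

theorem indicator_flowCone_exp_neg {q : CompleteCEdge n ⊕ Fin n → ℝ} (hq : ∀ i, 0 ≤ q i) :
    (flowCone n).indicator (fun q => ENNReal.ofReal (Real.exp (-positiveFlow n q))) q =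
      ∏ j, gammaKernel 0 (q (.inr j)) *
        gammaKernel 0 (q (.inr j) + netflow (fun e => q (.inl e)) j) := by
  by_cases h : ∀ j, 0 ≤ netflow (fun e => q (.inl e)) j + q (.inr j)
  · rw [indicator_of_mem (show q ∈ flowCone n from ⟨hq, h⟩)]
    have hj : ∀ j, gammaKernel 0 (q (.inr j)) *
        gammaKernel 0 (q (.inr j) + netflow (fun e => q (.inl e)) j) =
        ENNReal.ofReal (Real.exp (-(q (.inr j) +
          (netflow (fun e => q (.inl e)) j + q (.inr j))) / 2)) := by
      intro j
      rw [gammaKernel_of_nonneg _ (hq _), add_comm (q (.inr j)), gammaKernel_of_nonneg _ (h j),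
        ← ENNReal.ofReal_mul (by positivity)]
      simp only [pow_zero, Nat.factorial_zero, Nat.cast_one, div_one, one_mul, ← Real.exp_add]
      congr 2
      ring
    simp_rw [hj]
    rw [← ENNReal.ofReal_prod_of_nonneg fun j _ => (Real.exp_pos _).le, ← Real.exp_sum,
      ← Finset.sum_div, Finset.sum_neg_distrib, Finset.sum_add_distrib, ← two_mul_positiveFlow]
    congr 2
    ring
  · rw [indicator_of_notMem fun hmem => h hmem.2]
    push Not at h
    obtain ⟨j, hj⟩ := h
    refine (Finset.prod_eq_zero (Finset.mem_univ j) ?_).symm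
    rw [add_comm, gammaKernel_of_neg _ hj, mul_zero]

/-- For fixed flow on the inner edges, the integral over each `p_j` is by definition a
`twoSidedKernel 0 0` at the netflow. -/
theorem factorial_mul_volume_flowCone :
    ((Fintype.card (CompleteCEdge n ⊕ Fin n))! : ℝ≥0∞) *
      volume (flowCone n ∩ {q | positiveFlow n q ≤ 1}) =
        flowIntegral n (fun _ => 0) (fun _ => 0) := by
  have hsub : flowCone n ⊆ {q | ∀ i, 0 ≤ q i} := fun q hq => hq.1
  rw [← lintegral_cone_exp_neg measurableSet_flowCone ?_ (positiveFlow n)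
    fun q hq => positiveFlow_nonneg hq.1]
  · rw [← Measure.restrict_restrict_of_subset hsub, ← orthantMeasure_eq_restrict,
      ← lintegral_indicator measurableSet_flowCone]
    rw [lintegral_congr_ae ((ae_orthantMeasure_nonneg _).mono fun q hq =>
      indicator_flowCone_exp_neg hq), orthantMeasure, lintegral_pi_sum _ (by fun_prop),
      flowIntegral, orthantMeasure]
    refine lintegral_congr fun f => ?_
    simp only [Sum.elim_inl, Sum.elim_inr]
    rw [lintegral_pi_prod _ (g := fun j p => gammaKernel 0 p *
      gammaKernel 0 (p + netflow (fun e => f e) j)) (by fun_prop)]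
    refine Finset.prod_congr rfl fun j _ => ?_
    rw [lintegral_halfLine]
    · rfl
    · intro s hs
      rw [gammaKernel_of_neg _ hs, zero_mul]
  · rintro t ht q ⟨hq, hj⟩
    refine ⟨fun i => mul_nonneg ht.le (hq i), fun j => ?_⟩
    rw [netflow_smul, Pi.smul_apply, smul_eq_mul, ← mul_add]
    exact mul_nonneg ht.le (hj j)

theorem normalizedVolume_CRYC (n : ℕ) :
    normalizedVolume (CRYC n) = flowCount n (fun _ => 0) (fun _ => 0) := by
  have h := congrArg ENNReal.toReal (factorial_mul_volume_flowCone (n := n))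
  rw [flowIntegral_eq_flowCount, ENNReal.toReal_mul, ENNReal.toReal_natCast,
    ENNReal.toReal_natCast] at h
  rw [normalizedVolume_CRYC_eq_volume, measureReal_def, h]

end Coordinates

theorem mainTheorem3 (n : ℕ) :
    algebraMap ℝ (RatFun (Fin (n - 1))) (normalizedVolume (CRYC n)) =
      RatFun.iteratedCT
        ((∏ i : Fin (n - 1),
            (RatFun.x i)⁻¹ * ((1 - RatFun.x i) ^ 2)⁻¹ * (1 - 2 * RatFun.x i)⁻¹) *
          ∏ i : Fin (n - 1), ∏ j ∈ Finset.Ioi i,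
            (RatFun.x j - RatFun.x i)⁻¹ * (1 - RatFun.x j - RatFun.x i)⁻¹) := by
  -- For `n = 0` the truncated `n - 1` is `0`, and both counts are `1`.
  have hcount : flowCount n (fun _ => 0) (fun _ => 0) =
      flowCount (n - 1) (fun _ => 1) (fun _ => 1) := by
    cases n with
    | zero => rfl
    | succ n => exact flowCount_succ_zero n
  rw [normalizedVolume_CRYC, hcount, map_natCast, ← RatFun.iteratedCT_kernelProduct,
    RatFun.kernelProduct]
  simp only [pow_one, one_add_one_eq_two]
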